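/- All rings are commutative with $1$. An ideal $I$ of a ring $A$ is called *bounded nil* if there is an integer $m \ge 0$ such that the ideal $I^{[m]} := (f^m : f \in I)$ generated by the $m$-th powers of the elements of $I$ is zero. A ring map $R \to S$ is called *b-nil formally smooth* (resp. *b-nil formally étale*) if for every $R$-algebra $A$, every bounded nil ideal $I \subseteq A$ and every $R$-algebra homomorphism $g \colon S \to A/I$, there exists at least one (resp. exactly one) $R$-algebra homomorphism $f \colon S \to A$ whose composition with $A \to A/I$ is $g$. Formally smooth and formally étale are meant in the usual sense (with respect to the discrete topology). Let $L/K$ be an arbitrary extension of fields. Then: 1. $L/K$ is formally étale if and only if $L/K$ is b-nil formally étale. 2. The following are equivalent: - (i) $L/K$ is b-nil formally smooth; - (ii) $L/K$ is formally smooth; - (iii) $L$ is geometrically reduced over $K$, that is, $\overline{K} \otimes_K L$ is reduced, where $\overline{K}$ is an algebraic closure of $K$; - (iv) $L$ is a separable $K$-algebra, that is, $K' \otimes_K L$ is reduced for every field extension $K'/K$. -/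

import Mathlib

open scoped TensorProduct

universe u v w

/-- The ideal `I^[m]` generated by the `m`-th powers of the elements of `I`. -/
def Ideal.powersIdeal {A : Type w} [CommRing A] (I : Ideal A) (m : ℕ) : Ideal A :=
  Ideal.span {a : A | ∃ f ∈ I, a = f ^ m}

/-- An ideal is bounded nil (b-nil) if `I^[m] = 0` for some `m ≥ 0`. -/
def Ideal.IsBoundedNil {A : Type w} [CommRing A] (I : Ideal A) : Prop :=
  ∃ m : ℕ, I.powersIdeal m = ⊥

/-- `R → S` is b-nil formally smooth: for every bounded nil ideal `I` of an `R`-algebra `A`, every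
`R`-algebra map `S → A/I` lifts to an `R`-algebra map `S → A`. The test algebras `A` range over the
universe `w`, which is to be taken at least as large as those of `R` and `S`. -/
def BNilFormallySmooth (R : Type u) (S : Type v) [CommRing R] [CommRing S] [Algebra R S] : Prop :=
  ∀ (A : Type w) [CommRing A] [Algebra R A] (I : Ideal A), I.IsBoundedNil →
    ∀ g : S →ₐ[R] A ⧸ I, ∃ f : S →ₐ[R] A, (Ideal.Quotient.mkₐ R I).comp f = g

/-- `R → S` is b-nil formally étale: for every bounded nil ideal `I` of an `R`-algebra `A`, every
`R`-algebra map `S → A/I` lifts uniquely to an `R`-algebra map `S → A`. The test algebras `A` range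
over the universe `w`, which is to be taken at least as large as those of `R` and `S`. -/
def BNilFormallyEtale (R : Type u) (S : Type v) [CommRing R] [CommRing S] [Algebra R S] : Prop :=
  ∀ (A : Type w) [CommRing A] [Algebra R A] (I : Ideal A), I.IsBoundedNil →
    ∀ g : S →ₐ[R] A ⧸ I, ∃! f : S →ₐ[R] A, (Ideal.Quotient.mkₐ R I).comp f = g

/-- A (not necessarily algebraic or finite) `K`-algebra `S` is separable over the field `K` if
`K' ⊗[K] S` is reduced for every field extension `K'` of `K`. The extensions `K'` range over the
universe `w`, which is to be taken at least as large as that of `K`. -/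
def IsSeparableOverField (K : Type u) (S : Type v) [Field K] [CommRing S] [Algebra K S] : Prop :=
  ∀ (K' : Type w) [Field K'] [Algebra K K'], IsReduced (K' ⊗[K] S)

/-! In characteristic p the pivot is MacLane's condition: p-th powers of `K`-independent elements of
`L` stay independent. Geometric reducedness gives it by taking p-th roots in an algebraic closure;
formal smoothness gives it because L ⊗ Ω_K → Ω_L is injective and dc = 0 forces c to be a p-th power
(`Algebra.FormallySmooth.linearIndepOn_pow`). Conversely, the condition makes every base change to a
field reduced.

It also yields lifts. Filtering a bounded nil ideal by Frobenius reduces to a kernel killed by p-th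
powers. Pulling back to a surjection B → L, the condition makes K[Bᵖ] → L injective, and Zorn's
lemma enlarges K[Bᵖ] to the image of a section (`exists_section_of_forall_pow_mem`). Uniqueness in
the étale case comes from L = K[Lᵖ].

In characteristic 0 bounded nil ideals are nilpotent by polarization, every extension is formally
smooth, and base changes to fields are reduced. Square-zero ideals are bounded nil, which gives the
converse implications. -/

/-! ### Sections of surjections onto a field of characteristic p. -/

section Sections

variable {R : Type*} {L : Type*} {B : Type*} [CommRing R] [Field L] [CommRing B] [Algebra R L]
  [Algebra R B] {p : ℕ} [Fact p.Prime] {π : B →ₐ[R] L} {G : Subalgebra R B}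

/-- A subring mapping injectively to the field `L` and containing all `p`-th powers is a field. -/
lemma Subalgebra.isField_of_forall_pow_mem (hπ : Function.Surjective π) (hpow : ∀ b : B, b ^ p ∈ G)
    (hinj : ∀ g ∈ G, π g = 0 → g = 0) : IsField G where
  exists_pair_ne := ⟨0, 1, fun h ↦ zero_ne_one (α := L) <| by
    simpa using congr(π ($h : B))⟩
  mul_comm := mul_comm
  mul_inv_cancel := by
    rintro ⟨g, hg⟩ hg0
    have hg0' : π g ≠ 0 := fun h ↦ hg0 (Subtype.ext (hinj g hg h))
    obtain ⟨b, hb⟩ := hπ (π g)⁻¹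
    -- The lift `b` of the inverse need not lie in `G`, but `b ^ p` does.
    refine ⟨⟨g ^ (p - 1) * b ^ p, G.mul_mem (G.pow_mem hg _) (hpow b)⟩, Subtype.ext ?_⟩
    have hp : 1 + (p - 1) = p := Nat.add_sub_cancel' (Fact.out : p.Prime).one_le
    rw [← sub_eq_zero]
    refine hinj _ (G.sub_mem (G.mul_mem hg (G.mul_mem (G.pow_mem hg _) (hpow b))) G.one_mem) ?_
    change π (g * (g ^ (p - 1) * b ^ p) - 1) = 0
    rw [← mul_assoc, ← pow_succ', add_comm, hp, map_sub, map_mul, map_pow, map_pow, hb, map_one,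
      ← mul_pow, mul_inv_cancel₀ hg0', one_pow, sub_self]

variable [CharP L p]

/-- Let `B → L` be a surjection onto a field of characteristic `p`. A subring of `B` containing all
`p`-th powers on which the map is injective may be enlarged by any element of `B` whose image is
not already attained. -/
lemma Subalgebra.exists_le_mem_of_forall_pow_mem (hπ : Function.Surjective π)
    (hpow : ∀ b : B, b ^ p ∈ G) (hinj : ∀ g ∈ G, π g = 0 → g = 0) (b : B)
    (hb : ∀ g ∈ G, π g ≠ π b) :
    ∃ G' : Subalgebra R B, G ≤ G' ∧ b ∈ G' ∧ ∀ g ∈ G', π g = 0 → g = 0 := by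
  let _ : Field G := (Subalgebra.isField_of_forall_pow_mem hπ hpow hinj).toField
  let f : Polynomial G := .X ^ p - .C ⟨b ^ p, hpow b⟩
  have hf : Irreducible f := by
    -- A p-th root of `b ^ p` in `G` would have the same image as `b`, since Frobenius is injective
    -- on `L`.
    refine X_pow_sub_C_irreducible_of_prime Fact.out fun c hc ↦ hb c c.2 ?_
    have h : (c : B) ^ p = b ^ p := congrArg Subtype.val hc
    apply frobenius_inj L p
    simp only [frobenius_def, ← map_pow, h]
  have : Fact (Irreducible f) := ⟨hf⟩
  let φ : AdjoinRoot f →+* B := AdjoinRoot.lift G.val.toRingHom b (by simp [f])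
  -- `AdjoinRoot f` is a field, so injectivity is automatic; the range of `φ` is G[b].
  have hφ : Function.Injective ((π : B →+* L).comp φ) := RingHom.injective _
  have hof (g : G) : φ (AdjoinRoot.of f g) = g := by simp [φ]
  have hφR (r : R) : φ (AdjoinRoot.of f (algebraMap R G r)) = algebraMap R B r := hof _
  refine ⟨{ φ.range with algebraMap_mem' := fun r ↦ ⟨_, hφR r⟩ }, fun g hg ↦ ⟨_, hof ⟨g, hg⟩⟩,
    ⟨AdjoinRoot.root f, by simp [φ]⟩, ?_⟩
  rintro _ ⟨x, rfl⟩ hx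
  rw [show x = 0 from hφ (by simpa using hx), map_zero]

/-- Let `B → L` be a surjection onto a field of characteristic `p`, injective on a subring `G`
containing all `p`-th powers. Then it has a section whose range contains `G`. -/
lemma exists_section_of_forall_pow_mem (hπ : Function.Surjective π)
    (hpow : ∀ b : B, b ^ p ∈ G) (hinj : ∀ g ∈ G, π g = 0 → g = 0) :
    ∃ s : L →ₐ[R] B, π.comp s = AlgHom.id R L ∧ ∀ g ∈ G, s (π g) = g := by
  let S : Set (Subalgebra R B) := {H | ∀ g ∈ H, π g = 0 → g = 0}
  obtain ⟨M, hGM, hM⟩ := zorn_le_nonempty₀ S (fun c hc hchain y hy ↦ by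
    refine ⟨sSup c, fun g hg h0 ↦ ?_, fun z hz ↦ le_sSup hz⟩
    have : Nonempty c := ⟨⟨y, hy⟩⟩
    rw [sSup_eq_iSup', ← SetLike.mem_coe,
      Subalgebra.coe_iSup_of_directed hchain.directedOn.directed_val] at hg
    obtain ⟨H, hgH⟩ := Set.mem_iUnion.1 hg
    exact hc H.2 g hgH h0) G hinj
  have hsurj : ∀ x : L, ∃ g ∈ M, π g = x := by
    by_contra! h
    obtain ⟨x, hx⟩ := h
    obtain ⟨b, rfl⟩ := hπ x
    obtain ⟨M', hle, hbM', hM'⟩ := Subalgebra.exists_le_mem_of_forall_pow_mem hπ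
      (fun b ↦ hGM (hpow b)) hM.prop b hx
    exact hx b (hM.le_of_ge hM' hle hbM') rfl
  let e : M ≃ₐ[R] L := AlgEquiv.ofBijective (π.comp M.val)
    ⟨(injective_iff_map_eq_zero _).2 fun g hg ↦ Subtype.ext (hM.prop g g.2 hg),
      fun x ↦ by obtain ⟨g, hg, h⟩ := hsurj x; exact ⟨⟨g, hg⟩, h⟩⟩
  refine ⟨M.val.comp e.symm.toAlgHom, AlgHom.ext fun x ↦ e.apply_symm_apply x, fun g hg ↦ ?_⟩
  have := e.symm_apply_apply ⟨g, hGM hg⟩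
  exact congrArg Subtype.val this

end Sections

/-! ### Differentials and p-th powers. -/

section Kaehler

variable {R : Type*} {L : Type*} [CommRing R] [Field L] [Algebra R L]
  (p : ℕ) [Fact p.Prime] [CharP L p]

/-- If the differential of `x` vanishes then `x` lies in `R[Lᵖ]`. -/
lemma KaehlerDifferential.mem_adjoin_range_pow_of_D_eq_zero {x : L}
    (hx : KaehlerDifferential.D R L x = 0) :
    x ∈ Algebra.adjoin R (Set.range fun y : L ↦ y ^ p) := by
  by_contra hmem
  let A := Algebra.adjoin R (Set.range fun y : L ↦ y ^ p)
  let π : TrivSqZeroExt L L →ₐ[R] L := TrivSqZeroExt.fstHom R L L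
  let ι : L →ₐ[R] TrivSqZeroExt L L := TrivSqZeroExt.inlAlgHom R L L
  have hπι (y : L) : π (ι y) = y := rfl
  have hπ : Function.Surjective π := fun y ↦ ⟨ι y, hπι y⟩
  let G : Subalgebra R (TrivSqZeroExt L L) := A.map ι
  have hpow (b : TrivSqZeroExt L L) : b ^ p ∈ G := by
    refine ⟨b.fst ^ p, Algebra.subset_adjoin ⟨_, rfl⟩, ?_⟩
    refine TrivSqZeroExt.ext ?_ ?_
    · simp [ι]
    · simp [ι, TrivSqZeroExt.snd_pow, ← Nat.cast_smul_eq_nsmul L, CharP.cast_eq_zero]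
  have hinj : ∀ g ∈ G, π g = 0 → g = 0 := by
    rintro _ ⟨y, -, rfl⟩ (h : y = 0)
    simp [h]
  -- With x + ε adjoined to `G`, the section sends x to x + ε, so its ε-component is a derivation
  -- taking x to 1.
  let b : TrivSqZeroExt L L := TrivSqZeroExt.inl x + TrivSqZeroExt.inr 1
  have hπb : π b = x := by simp [π, b]
  obtain ⟨G', hle, hb, hG'⟩ := Subalgebra.exists_le_mem_of_forall_pow_mem hπ hpow hinj b (by
    rintro _ ⟨y, hy, rfl⟩ h
    refine hmem ?_
    rw [hπb] at h
    exact h ▸ hy)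
  obtain ⟨s, hs, hsG⟩ := exists_section_of_forall_pow_mem hπ (fun c ↦ hle (hpow c)) hG'
  have hfst (y : L) : (s y).fst = y := DFunLike.congr_fun hs y
  let D : Derivation R L L := Derivation.mk'
    ((TrivSqZeroExt.sndHom L L).restrictScalars R ∘ₗ s.toLinearMap) fun y z ↦ by simp [hfst, mul_comm]
  have hDx : D x = 1 := by
    change (s x).snd = 1
    rw [← hπb, hsG b hb]
    simp [b]
  have := congr(D.liftKaehlerDifferential $hx)
  simp [hDx] at this

/-- If `L` is formally unramified over `R`, then `L = R[Lᵖ]`. -/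
lemma Algebra.FormallyUnramified.adjoin_range_pow_eq_top [Algebra.FormallyUnramified R L] :
    Algebra.adjoin R (Set.range fun y : L ↦ y ^ p) = ⊤ :=
  Algebra.eq_top_iff.2 fun _ ↦
    KaehlerDifferential.mem_adjoin_range_pow_of_D_eq_zero p (Subsingleton.elim _ _)

/-- In a field of characteristic `p`, an element with zero absolute differential is a `p`-th
power. -/
lemma KaehlerDifferential.exists_pow_eq_of_D_eq_zero {x : L}
    (hx : KaehlerDifferential.D ℤ L x = 0) : ∃ y : L, y ^ p = x := by
  have h := KaehlerDifferential.mem_adjoin_range_pow_of_D_eq_zero p hx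
  have hle : Algebra.adjoin ℤ (Set.range fun y : L ↦ y ^ p) ≤
      subalgebraOfSubring (frobenius L p).range :=
    Algebra.adjoin_le (by rintro _ ⟨y, rfl⟩; exact ⟨y, rfl⟩)
  exact hle h

end Kaehler

/-! ### Formal smoothness implies MacLane's condition. -/

section Independence

variable {K : Type*} {L : Type*} [Field K] [Field L] [Algebra K L] (p : ℕ) [Fact p.Prime]

/-- Pure tensors with linearly independent left factors sum to zero only if all right factors
vanish. -/
lemma LinearIndepOn.eq_zero_of_sum_tmul_eq_zero {ι V W : Type*} [AddCommGroup V] [Module K V]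
    [AddCommGroup W] [Module K W] {v : ι → V} {s : Finset ι} (hv : LinearIndepOn K v (s : Set ι))
    {w : ι → W} (h : ∑ i ∈ s, v i ⊗ₜ[K] w i = 0) : ∀ i ∈ s, w i = 0 := by
  classical
  intro i hi
  obtain ⟨g, hg⟩ := LinearMap.exists_leftInverse_of_injective
    (Finsupp.linearCombination K fun j : (s : Set ι) ↦ v j) (LinearMap.ker_eq_bot.2 hv)
  let f : V →ₗ[K] K := Finsupp.lapply ⟨i, hi⟩ ∘ₗ g
  have hf : ∀ j ∈ s, f (v j) = if j = i then 1 else 0 := fun j hj ↦ by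
    have := DFunLike.congr_fun hg (Finsupp.single ⟨j, hj⟩ 1)
    simp only [LinearMap.comp_apply, Finsupp.linearCombination_single, one_smul,
      LinearMap.id_apply] at this
    simp [f, this, Finsupp.single_apply]
  have := congr(TensorProduct.lid K W (f.rTensor W $h))
  rw [map_sum, map_sum, map_zero, map_zero, Finset.sum_eq_single_of_mem i hi] at this
  · simpa [hf i hi] using this
  · intro j hj hji
    simp [hf j hj, hji]

/-- If `L / K` is formally smooth of characteristic `p`, then raising to the `p`-th power preserves
`K`-linear independence of elements of `L`. -/
lemma Algebra.FormallySmooth.linearIndepOn_pow [CharP K p] [Algebra.FormallySmooth K L]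
    (s : Finset L) (hs : LinearIndepOn K _root_.id (s : Set L)) :
    LinearIndepOn K (· ^ p) (s : Set L) := by
  classical
  have : CharP L p := charP_of_injective_algebraMap (algebraMap K L).injective p
  induction s using Finset.induction_on with
  | empty => simp
  | insert x s hxs ih =>
    rw [Finset.coe_insert] at hs ⊢
    have hxs' : x ∉ (s : Set L) := by simpa
    rw [linearIndepOn_insert hxs'] at hs ⊢
    have ihs := ih hs.1
    refine ⟨ihs, fun hmem ↦ hs.2 ?_⟩
    rw [Submodule.mem_span_image_finset_iff_exists_fun'] at hmem
    obtain ⟨c, hc⟩ := hmem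
    have hDpow (y : L) : KaehlerDifferential.D ℤ L (y ^ p) = 0 := by
      rw [Derivation.leibniz_pow, ← Nat.cast_smul_eq_nsmul L, CharP.cast_eq_zero, zero_smul]
    -- The obstruction to injectivity is the image of `H1Cotangent`, which vanishes by formal
    -- smoothness.
    have hinj : Function.Injective (KaehlerDifferential.mapBaseChange ℤ K L) := by
      rw [injective_iff_map_eq_zero]
      intro y hy
      obtain ⟨z, rfl⟩ := (Algebra.H1Cotangent.exact_δ_mapBaseChange ℤ K L y).mp hy
      rw [Subsingleton.elim z 0, map_zero]
    -- This is the differential of xᵖ = ∑ c_y yᵖ, pulled back to L ⊗ Ω_K. It forces dc_y = 0, so c_y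
    -- = d_yᵖ and x = ∑ d_y y.
    have hsum : ∑ y ∈ s, (y ^ p) ⊗ₜ[K] KaehlerDifferential.D ℤ K (c y) = 0 := by
      apply hinj
      rw [map_zero, map_sum, ← hDpow x, ← hc, map_sum]
      refine Finset.sum_congr rfl fun y _ ↦ ?_
      rw [KaehlerDifferential.mapBaseChange_tmul, KaehlerDifferential.map_D, Algebra.smul_def,
        Derivation.leibniz, hDpow, smul_zero, zero_add]
    have hzero : ∀ y ∈ s, KaehlerDifferential.D ℤ K (c y) = 0 :=
      ihs.eq_zero_of_sum_tmul_eq_zero hsum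
    have hroot : ∀ y ∈ s, ∃ d : K, d ^ p = c y := fun y hy ↦
      KaehlerDifferential.exists_pow_eq_of_D_eq_zero p (hzero y hy)
    choose! d hd using hroot
    rw [Submodule.mem_span_image_finset_iff_exists_fun']
    refine ⟨d, frobenius_inj L p ?_⟩
    rw [frobenius_def, sum_pow_char, frobenius_def, id_eq, ← hc]
    refine Finset.sum_congr rfl fun y hy ↦ ?_
    rw [smul_pow, hd y hy, id_eq]

end Independence

/-! ### One step of the Frobenius filtration. -/

section FrobeniusKernel

/-- If all elements of `I` satisfy `x ^ p ^ (n + 1) = 0`, all elements of `I^[p]` satisfy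
`x ^ p ^ n = 0`. -/
lemma Ideal.pow_eq_zero_of_mem_powersIdeal (K : Type*) [Field K] (p : ℕ) [Fact p.Prime]
    [CharP K p] {A : Type*} [CommRing A] [Algebra K A] {I : Ideal A} {n : ℕ}
    (hI : ∀ a ∈ I, a ^ p ^ (n + 1) = 0) {a : A} (ha : a ∈ I.powersIdeal p) : a ^ p ^ n = 0 := by
  cases subsingleton_or_nontrivial A
  · exact Subsingleton.elim _ _
  have : CharP A p := charP_of_injective_algebraMap (algebraMap K A).injective p
  have hp : p ^ n ≠ 0 := pow_ne_zero _ (Fact.out : p.Prime).ne_zero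
  induction ha using Submodule.span_induction with
  | mem x hx =>
    obtain ⟨f, hf, rfl⟩ := hx
    rw [← pow_mul, ← pow_succ']
    exact hI f hf
  | zero => exact zero_pow hp
  | add x y _ _ hx hy => rw [add_pow_char_pow, hx, hy, add_zero]
  | smul a x _ hx => rw [smul_pow, hx, smul_zero]

variable {K A C : Type*} [Field K] [CommRing A] [Algebra K A] [CommRing C] [Algebra K C] (p : ℕ)
  [Fact p.Prime]

/-- The map induced by `f` on the quotient by the `p`-th powers of elements of its kernel. -/
def AlgHom.kerPowersLift (f : A →ₐ[K] C) : A ⧸ (RingHom.ker f).powersIdeal p →ₐ[K] C :=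
  Ideal.Quotient.liftₐ _ f fun a ha ↦ by
    have hle : (RingHom.ker f).powersIdeal p ≤ RingHom.ker f := Ideal.span_le.2 <| by
      rintro _ ⟨y, hy, rfl⟩
      exact Ideal.pow_mem_of_mem _ hy _ (Fact.out : p.Prime).pos
    exact hle ha

lemma AlgHom.pow_eq_zero_of_kerPowersLift_eq_zero (f : A →ₐ[K] C)
    (a : A ⧸ (RingHom.ker f).powersIdeal p) (ha : f.kerPowersLift p a = 0) : a ^ p = 0 := by
  obtain ⟨a, rfl⟩ := Ideal.Quotient.mk_surjective a
  rw [← map_pow, Ideal.Quotient.eq_zero_iff_mem]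
  exact Ideal.subset_span ⟨a, ha, rfl⟩

end FrobeniusKernel

/-! ### Consequences of MacLane's condition: reducedness and lifting. -/

section PowIndependent

variable {K : Type*} {L : Type*} [Field K] [Field L] [Algebra K L] (p : ℕ)
  (H : ∀ s : Finset L, LinearIndepOn K _root_.id (s : Set L) → LinearIndepOn K (· ^ p) (s : Set L))

include H in
-- Passes from finite subsets to families, so that `H` applies to a basis of `L`.
lemma LinearIndependent.pow_of_forall_finset {ι : Type*} {v : ι → L}
    (hv : LinearIndependent K v) : LinearIndependent K fun i ↦ v i ^ p := by
  classical
  rw [linearIndependent_iff']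
  intro s c hc
  have h := H (s.image v) (by
    rw [Finset.coe_image]
    exact (hv.linearIndepOn s).id_image)
  rw [Finset.coe_image] at h
  exact linearIndepOn_finset_iff.1 (h.comp_of_image hv.injective.injOn) c hc

variable [Fact p.Prime] [CharP K p]

/-- A field extension with a reduced base change along an extension containing the `p`-th roots of
all elements of the base has the property that raising to the `p`-th power preserves linear
independence. -/
lemma linearIndepOn_pow_of_isReduced_tensorProduct {K' : Type*} [Field K'] [Algebra K K']
    [IsReduced (K' ⊗[K] L)] (hroot : ∀ c : K, ∃ d : K', d ^ p = algebraMap K K' c)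
    (s : Finset L) (hs : LinearIndepOn K _root_.id (s : Set L)) :
    LinearIndepOn K (· ^ p) (s : Set L) := by
  have : CharP (K' ⊗[K] L) p := charP_of_injective_algebraMap (algebraMap K (K' ⊗[K] L)).injective p
  rw [linearIndepOn_finset_iff]
  intro c hc i hi
  choose d hd using fun i ↦ hroot (c i)
  -- With d_iᵖ = c_i, the p-th power is 1 ⊗ ∑ c_i iᵖ, which is the given relation.
  have hx : (∑ i ∈ s, d i ⊗ₜ[K] i) ^ p = 0 := by
    rw [sum_pow_char]
    simp only [Algebra.TensorProduct.tmul_pow, hd, Algebra.algebraMap_eq_smul_one,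
      TensorProduct.smul_tmul]
    rw [← TensorProduct.tmul_sum, hc, TensorProduct.tmul_zero]
  have hx' := congr(TensorProduct.comm K K' L $(eq_zero_of_pow_eq_zero hx))
  rw [map_sum, map_zero] at hx'
  have hdi : d i = 0 := hs.eq_zero_of_sum_tmul_eq_zero hx' i hi
  have := hd i
  rw [hdi, zero_pow (Fact.out : p.Prime).ne_zero] at this
  exact (map_eq_zero _).1 this.symm

include H in
/-- If raising to the `p`-th power preserves linear independence, all base changes to fields are
reduced. -/
lemma isReduced_tensorProduct_of_linearIndepOn_pow (K' : Type*) [Field K'] [Algebra K K'] :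
    IsReduced (K' ⊗[K] L) := by
  have : CharP (K' ⊗[K] L) p := charP_of_injective_algebraMap (algebraMap K (K' ⊗[K] L)).injective p
  rw [isReduced_iff_pow_one_lt p (Fact.out : p.Prime).one_lt]
  intro x hx
  let β := Module.Basis.ofVectorSpace K L
  let b := Algebra.TensorProduct.basis K' β
  have hβ := (β.linearIndependent.pow_of_forall_finset p H).linearIndepOn (b.repr x).support
  have hsum : x = ∑ j ∈ (b.repr x).support, b.repr x j ⊗ₜ[K] β j := by
    conv_lhs => rw [← b.linearCombination_repr x, Finsupp.linearCombination_apply, Finsupp.sum]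
    simp [b, TensorProduct.smul_tmul']
  rw [hsum, sum_pow_char] at hx
  simp only [Algebra.TensorProduct.tmul_pow] at hx
  have hx' := congr(TensorProduct.comm K K' L $hx)
  rw [map_sum, map_zero] at hx'
  have h0 := hβ.eq_zero_of_sum_tmul_eq_zero hx'
  rw [hsum]
  refine Finset.sum_eq_zero fun j hj ↦ ?_
  rw [eq_zero_of_pow_eq_zero (h0 j hj), TensorProduct.zero_tmul]

section Lifting

variable {B : Type*} [CommRing B] [Algebra K B]

include H in
/-- If the kernel of `B → L` is killed by Frobenius, then `K[Bᵖ] → L` is injective. -/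
lemma eq_zero_of_mem_adjoin_range_pow {π : B →ₐ[K] L} (hπ : Function.Surjective π)
    (hker : ∀ b, π b = 0 → b ^ p = 0) {g : B}
    (hg : g ∈ Algebra.adjoin K (Set.range fun b : B ↦ b ^ p)) (h0 : π g = 0) : g = 0 := by
  have : Nontrivial B := hπ.nontrivial
  have : CharP B p := charP_of_injective_algebraMap (algebraMap K B).injective p
  let β := Module.Basis.ofVectorSpace K L
  let σ := Function.surjInv hπ
  have hσ (y : L) : π (σ y) = y := Function.surjInv_eq hπ y
  have hmem : g ∈ Submodule.span K (Set.range fun j ↦ σ (β j) ^ p) := by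
    have hadj : g ∈ Submodule.span K (Set.range fun b : B ↦ b ^ p) := by
      rw [← Subalgebra.mem_toSubmodule, Algebra.adjoin_eq_span] at hg
      convert! hg
      exact congrArg SetLike.coe
        (Submonoid.closure_eq (MonoidHom.mrange (powMonoidHom p : B →* B))).symm
    refine Submodule.span_le.2 ?_ hadj
    rintro _ ⟨b, rfl⟩
    -- `b ^ p` depends only on `π b`, so `b` may be replaced by a combination of lifts of basis
    -- elements.
    let b' := ∑ j ∈ (β.repr (π b)).support, β.repr (π b) j • σ (β j)
    have hb' : π b' = π b := by
      conv_rhs => rw [← β.linearCombination_repr (π b), Finsupp.linearCombination_apply,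
        Finsupp.sum]
      simp [b', hσ]
    have hbb' : b ^ p = b' ^ p := by
      rw [← sub_eq_zero, ← sub_pow_char]
      exact hker _ (by rw [map_sub, hb', sub_self])
    simp only [SetLike.mem_coe, hbb', b', sum_pow_char]
    refine Submodule.sum_mem _ fun j _ ↦ ?_
    rw [smul_pow]
    exact Submodule.smul_mem _ _ (Submodule.subset_span ⟨j, rfl⟩)
  obtain ⟨c, rfl⟩ := Finsupp.mem_span_range_iff_exists_finsupp.1 hmem
  have hβ := β.linearIndependent.pow_of_forall_finset p H
  have : c = 0 := (linearIndependent_iff.1 hβ) c (by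
    rw [← h0, Finsupp.linearCombination_apply, Finsupp.sum, Finsupp.sum, map_sum]
    simp [hσ])
  simp [this]

variable {A : Type*} {C : Type*} [CommRing A] [Algebra K A] [CommRing C] [Algebra K C]

include H in
/-- Lifting along surjections whose kernel is killed by Frobenius. -/
lemma exists_lift_of_ker_pow_prime_eq_zero {f : A →ₐ[K] C} (hf : Function.Surjective f)
    (hker : ∀ a, f a = 0 → a ^ p = 0) (g : L →ₐ[K] C) : ∃ h : L →ₐ[K] A, f.comp h = g := by
  -- The fibre product L ×_C A: a section of its projection to `L` is a lift of `g`, and the kernel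
  -- is that of `f`.
  let B := AlgHom.equalizer (g.comp (AlgHom.fst K L A)) (f.comp (AlgHom.snd K L A))
  let π : B →ₐ[K] L := (AlgHom.fst K L A).comp B.val
  have hπ : Function.Surjective π := fun y ↦ by
    obtain ⟨a, ha⟩ := hf (g y)
    exact ⟨⟨(y, a), ha.symm⟩, rfl⟩
  have : CharP L p := charP_of_injective_algebraMap (algebraMap K L).injective p
  obtain ⟨s, hs, -⟩ := exists_section_of_forall_pow_mem (p := p) hπ
    (G := Algebra.adjoin K (Set.range fun b : B ↦ b ^ p))
    (fun b ↦ Algebra.subset_adjoin ⟨b, rfl⟩)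
    (fun _ hg h0 ↦ eq_zero_of_mem_adjoin_range_pow p H hπ (by
      rintro ⟨⟨y, a⟩, hb⟩ (rfl : y = 0)
      have ha : f a = 0 := hb.symm.trans (map_zero g)
      refine Subtype.ext (Prod.ext ?_ (hker a ha))
      exact zero_pow (Fact.out : p.Prime).ne_zero) hg h0)
  refine ⟨((AlgHom.snd K L A).comp B.val).comp s, AlgHom.ext fun y ↦ ?_⟩
  have h1 : g (s y : L × A).1 = f (s y : L × A).2 := (s y).2
  have h2 : (s y : L × A).1 = y := DFunLike.congr_fun hs y
  rw [h2] at h1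
  exact h1.symm

end Lifting

section FrobeniusFiltration

variable {A : Type*} {C : Type*} [CommRing A] [Algebra K A] [CommRing C] [Algebra K C]

include H in
/-- Lifting along surjections whose kernel is killed by a power of Frobenius. -/
lemma exists_lift_of_ker_pow_prime_pow_eq_zero {A C : Type u} [CommRing A] [Algebra K A]
    [CommRing C] [Algebra K C] (n : ℕ) {f : A →ₐ[K] C} (hf : Function.Surjective f)
    (hker : ∀ a, f a = 0 → a ^ p ^ n = 0) (g : L →ₐ[K] C) : ∃ h : L →ₐ[K] A, f.comp h = g := by
  -- The step replaces `C` by A/(ker f)^[p], hence the common universe of `A` and `C`.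
  induction n generalizing C with
  | zero =>
    refine exists_lift_of_ker_pow_prime_eq_zero p H hf (fun a ha ↦ ?_) g
    have := hker a ha
    rw [pow_zero, pow_one] at this
    rw [this, zero_pow (Fact.out : p.Prime).ne_zero]
  | succ n ih =>
    obtain ⟨g', hg'⟩ := exists_lift_of_ker_pow_prime_eq_zero p H (f := f.kerPowersLift p)
      (fun c ↦ by obtain ⟨a, rfl⟩ := hf c; exact ⟨Ideal.Quotient.mk _ a, rfl⟩)
      (f.pow_eq_zero_of_kerPowersLift_eq_zero p) g
    obtain ⟨h, hh⟩ := ih (f := Ideal.Quotient.mkₐ K ((RingHom.ker f).powersIdeal p))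
      (Ideal.Quotient.mkₐ_surjective _ _)
      (fun a ha ↦ Ideal.pow_eq_zero_of_mem_powersIdeal K p (I := RingHom.ker f) hker
        (Ideal.Quotient.eq_zero_iff_mem.1 ha)) g'
    exact ⟨h, by rw [← hg', ← hh]; rfl⟩

/-- Uniqueness of lifts along maps whose kernel is killed by Frobenius. -/
lemma Algebra.FormallyUnramified.algHom_ext_of_ker_pow_prime_eq_zero
    [Algebra.FormallyUnramified K L] {f : A →ₐ[K] C} (hker : ∀ a, f a = 0 → a ^ p = 0)
    {h₁ h₂ : L →ₐ[K] A} (h : f.comp h₁ = f.comp h₂) : h₁ = h₂ := by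
  cases subsingleton_or_nontrivial A
  · exact AlgHom.ext fun _ ↦ Subsingleton.elim _ _
  have : CharP A p := charP_of_injective_algebraMap (algebraMap K A).injective p
  have : CharP L p := charP_of_injective_algebraMap (algebraMap K L).injective p
  refine AlgHom.ext_of_adjoin_eq_top
    (Algebra.FormallyUnramified.adjoin_range_pow_eq_top (R := K) (L := L) p) ?_
  rintro _ ⟨y, rfl⟩
  simp only [map_pow]
  -- The two lifts of `y` differ by an element of the kernel, so their p-th powers agree.
  rw [← sub_eq_zero, ← sub_pow_char]
  refine hker _ ?_
  rw [map_sub, sub_eq_zero]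
  exact DFunLike.congr_fun h y

/-- Uniqueness of lifts along maps whose kernel is killed by a power of Frobenius. -/
lemma Algebra.FormallyUnramified.algHom_ext_of_ker_pow_prime_pow_eq_zero
    [Algebra.FormallyUnramified K L] {A C : Type u} [CommRing A] [Algebra K A]
    [CommRing C] [Algebra K C] (n : ℕ) {f : A →ₐ[K] C}
    (hker : ∀ a, f a = 0 → a ^ p ^ n = 0) {h₁ h₂ : L →ₐ[K] A} (h : f.comp h₁ = f.comp h₂) :
    h₁ = h₂ := by
  induction n generalizing C with
  | zero =>
    refine algHom_ext_of_ker_pow_prime_eq_zero p (fun a ha ↦ ?_) h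
    have := hker a ha
    rw [pow_zero, pow_one] at this
    rw [this, zero_pow (Fact.out : p.Prime).ne_zero]
  | succ n ih =>
    refine ih (f := Ideal.Quotient.mkₐ K ((RingHom.ker f).powersIdeal p))
      (fun a ha ↦ Ideal.pow_eq_zero_of_mem_powersIdeal K p (I := RingHom.ker f) hker
        (Ideal.Quotient.eq_zero_iff_mem.1 ha)) ?_
    exact algHom_ext_of_ker_pow_prime_eq_zero p (f.pow_eq_zero_of_kerPowersLift_eq_zero p)
      (AlgHom.ext fun x ↦ DFunLike.congr_fun h x)

end FrobeniusFiltration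

end PowIndependent

/-! ### Characteristic zero: bounded nil ideals are nilpotent. -/

section CharZero

variable {K : Type*} [Field K] [CharZero K]

variable (K) in
/-- In an algebra over a field of characteristic zero, an ideal all of whose elements satisfy
`f ^ (m + 1) = 0` also satisfies `g * f ^ m = 0` for all elements `f` and `g`. -/
lemma Ideal.mul_pow_eq_zero_of_forall_pow_succ_eq_zero {A : Type*} [CommRing A] [Algebra K A]
    {I : Ideal A} {m : ℕ} (hI : ∀ f ∈ I, f ^ (m + 1) = 0) {f g : A} (hf : f ∈ I) (hg : g ∈ I) :
    g * f ^ m = 0 := by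
  rw [← Module.forall_dual_apply_eq_zero_iff K]
  intro φ
  -- q(t) = φ((t g + f)^(m+1)) vanishes on the infinite field `K`; its linear coefficient is (m+1)
  -- φ(g f^m).
  let q : Polynomial K := ∑ i ∈ Finset.range (m + 1 + 1),
    Polynomial.monomial i (((m + 1).choose i : K) * φ (g ^ i * f ^ (m + 1 - i)))
  have hq : q = 0 := by
    refine Polynomial.funext fun t ↦ ?_
    have h0 : φ ((t • g + f) ^ (m + 1)) = 0 := by
      rw [hI _ (I.add_mem (Submodule.smul_of_tower_mem I t hg) hf), map_zero]
    rw [Polynomial.eval_zero, ← h0, add_pow, map_sum, Polynomial.eval_finsetSum]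
    refine Finset.sum_congr rfl fun i _ ↦ ?_
    have : (t • g) ^ i * f ^ (m + 1 - i) * ((m + 1).choose i : A) =
        (t ^ i * ((m + 1).choose i : K)) • (g ^ i * f ^ (m + 1 - i)) := by
      simp only [Algebra.smul_def, map_mul, map_pow, map_natCast]
      ring
    rw [Polynomial.eval_monomial, this, map_smul, smul_eq_mul]
    ring
  have h1 := congr(Polynomial.coeff $hq 1)
  simp only [q, Polynomial.finsetSum_coeff, Polynomial.coeff_monomial, Polynomial.coeff_zero] at h1
  rw [Finset.sum_eq_single_of_mem 1 (by simp) (by simp +contextual)] at h1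
  have hm : (m : K) + 1 ≠ 0 := by exact_mod_cast Nat.succ_ne_zero m
  simpa [hm] using h1

variable (K) in
/-- In an algebra over a field of characteristic zero, an ideal whose elements are nilpotent of
bounded exponent is nilpotent. -/
lemma Ideal.isNilpotent_of_forall_pow_eq_zero {A : Type*} [CommRing A] [Algebra K A]
    {I : Ideal A} {m : ℕ} (hI : ∀ f ∈ I, f ^ m = 0) : IsNilpotent I := by
  induction m generalizing A with
  | zero =>
    have : Subsingleton A := subsingleton_of_zero_eq_one (by simpa using (hI 0 I.zero_mem).symm)
    exact ⟨1, Subsingleton.elim _ _⟩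
  | succ m ih =>
    -- By induction I^k ⊆ J, and I · J = 0 by polarization, so I^(k+1) = 0.
    let J := I.powersIdeal m
    obtain ⟨k, hk⟩ := ih (A := A ⧸ J) (I := I.map (Ideal.Quotient.mk J)) (fun f hf ↦ by
      obtain ⟨f, hfI, rfl⟩ := (Ideal.mem_map_iff_of_surjective _ Ideal.Quotient.mk_surjective).1 hf
      rw [← map_pow, Ideal.Quotient.eq_zero_iff_mem]
      exact Ideal.subset_span ⟨f, hfI, rfl⟩)
    have hkJ : I ^ k ≤ J := by
      rw [← Ideal.map_pow, Ideal.zero_eq_bot, Ideal.map_eq_bot_iff_le_ker, Ideal.mk_ker] at hk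
      exact hk
    refine ⟨k + 1, ?_⟩
    rw [pow_succ, Ideal.zero_eq_bot, eq_bot_iff]
    refine (Ideal.mul_mono_left hkJ).trans (Ideal.mul_le.2 fun x hx y hy ↦ ?_)
    have hle : J ≤ LinearMap.ker (LinearMap.mulLeft A y) := Ideal.span_le.2 <| by
      rintro _ ⟨f, hf, rfl⟩
      exact Ideal.mul_pow_eq_zero_of_forall_pow_succ_eq_zero K hI hf hy
    rw [mul_comm]
    exact hle hx

variable {L : Type*} [Field L] [Algebra K L]

variable (K L) in
/-- All field extensions in characteristic zero are formally smooth. -/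
lemma Algebra.FormallySmooth.of_charZero : Algebra.FormallySmooth K L := by
  obtain ⟨ι, v, hv⟩ := exists_isTranscendenceBasis' K L
  have := hv.isAlgebraic_field
  exact .of_algebraicIndependent_of_isSeparable hv.1

end CharZero

/-! ### Reduced base changes via separable and purely transcendental extensions. -/

section Reduced

/-- The base change of a separable algebraic extension to a field is reduced. -/
lemma isReduced_tensorProduct_of_isSeparable (F E L : Type*) [Field F] [Field E] [Field L]
    [Algebra F E] [Algebra F L] [Algebra.IsSeparable F L] : IsReduced (E ⊗[F] L) := by
  refine IsReduced.tensorProduct_of_flat_of_forall_fg fun B hB ↦ ?_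
  obtain ⟨t, rfl⟩ := hB
  let M := IntermediateField.adjoin F (t : Set L)
  have : Algebra.EssFiniteType F M := (IntermediateField.essFiniteType_iff).2 ⟨t, rfl⟩
  have : Algebra.FormallyUnramified F M := Algebra.FormallyUnramified.of_isSeparable F M
  have : IsReduced (E ⊗[F] M) := Algebra.FormallyUnramified.isReduced_of_field E (E ⊗[F] M)
  let j : Algebra.adjoin F (t : Set L) →ₐ[F] M :=
    Subalgebra.inclusion (IntermediateField.algebra_adjoin_le_adjoin F (t : Set L))
  exact isReduced_of_injective (Algebra.TensorProduct.map (AlgHom.id E E) j)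
    (Module.Flat.lTensor_preserves_injective_linearMap j.toLinearMap
      (Subalgebra.inclusion_injective
        (IntermediateField.algebra_adjoin_le_adjoin F (t : Set L))))

/-- If `P ⊗ K'` is a domain, so is `Frac P ⊗ K'`. -/
lemma IsFractionRing.isDomain_tensorProduct (K P F K' : Type*) [Field K] [CommRing P] [IsDomain P]
    [Field F] [Field K'] [Algebra K P] [Algebra K F] [Algebra K K'] [Algebra P F]
    [IsScalarTower K P F] [IsFractionRing P F] [IsDomain (P ⊗[K] K')] : IsDomain (F ⊗[K] K') := by
  let j : P ⊗[K] K' →ₐ[P] F ⊗[K] K' :=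
    Algebra.TensorProduct.map (IsScalarTower.toAlgHom P P F) (AlgHom.id K K')
  let _ : Algebra (P ⊗[K] K') (F ⊗[K] K') := j.toRingHom.toAlgebra
  have : IsScalarTower P (P ⊗[K] K') (F ⊗[K] K') :=
    .of_algebraMap_eq fun x ↦ (j.commutes x).symm
  have : IsLocalization (Algebra.algebraMapSubmonoid (P ⊗[K] K') (nonZeroDivisors P))
      (F ⊗[K] K') := by
    refine IsLocalization.tensorProduct_tensorProduct K K' _ F (RingHom.ext fun x ↦ ?_)
    change j (1 ⊗ₜ x) = 1 ⊗ₜ x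
    simp [j]
  refine IsLocalization.isDomain_of_le_nonZeroDivisors (F ⊗[K] K')
    (M := Algebra.algebraMapSubmonoid (P ⊗[K] K') (nonZeroDivisors P)) ?_
  rintro _ ⟨x, hx, rfl⟩
  rw [SetLike.mem_coe, mem_nonZeroDivisors_iff_ne_zero] at hx
  rw [mem_nonZeroDivisors_iff_ne_zero]
  have hinj : Function.Injective (algebraMap P (P ⊗[K] K')) :=
    Algebra.TensorProduct.includeLeft_injective (S := K) (algebraMap K K').injective
  exact fun h ↦ hx (hinj (h.trans (map_zero _).symm))

open scoped IntermediateField.algebraAdjoinAdjoin in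
/-- The base change of a purely transcendental extension to a field is a domain. -/
lemma AlgebraicIndependent.isDomain_adjoin_tensorProduct {K L ι : Type*} [Field K] [Field L]
    [Algebra K L] {v : ι → L} (hv : AlgebraicIndependent K v) (K' : Type*) [Field K']
    [Algebra K K'] : IsDomain (IntermediateField.adjoin K (Set.range v) ⊗[K] K') := by
  have : IsDomain (Algebra.adjoin K (Set.range v) ⊗[K] K') :=
    ((Algebra.TensorProduct.congr hv.aevalEquiv.symm AlgEquiv.refl).trans <|
      (Algebra.TensorProduct.comm K _ _).trans <|
      (MvPolynomial.algebraTensorAlgEquiv K K').restrictScalars K).toMulEquiv.isDomain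
  exact IsFractionRing.isDomain_tensorProduct K (Algebra.adjoin K (Set.range v)) _ _

/-- If `L / F` is separable algebraic and `F ⊗ K'` is a domain, then `K' ⊗ L` is reduced. -/
lemma isReduced_tensorProduct_of_isDomain (K F L K' : Type*) [Field K] [Field F] [Field L]
    [Field K'] [Algebra K F] [Algebra K L] [Algebra F L] [IsScalarTower K F L] [Algebra K K']
    [Algebra.IsSeparable F L] [IsDomain (F ⊗[K] K')] : IsReduced (K' ⊗[K] L) := by
  -- K' ⊗_K L ≅ L ⊗_F (F ⊗_K K') embeds in L ⊗_F E by flatness, reducing to the separable algebraic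
  -- case.
  let E := FractionRing (F ⊗[K] K')
  let j : F ⊗[K] K' →ₐ[F] E := IsScalarTower.toAlgHom F (F ⊗[K] K') E
  have : IsReduced (L ⊗[F] E) :=
    have := isReduced_tensorProduct_of_isSeparable F E L
    isReduced_of_injective _ (Algebra.TensorProduct.comm F L E).injective
  have : IsReduced (L ⊗[F] (F ⊗[K] K')) :=
    isReduced_of_injective (Algebra.TensorProduct.map (AlgHom.id F L) j)
      (Module.Flat.lTensor_preserves_injective_linearMap j.toLinearMap
        (IsFractionRing.injective (F ⊗[K] K') E))
  exact isReduced_of_injective _ ((Algebra.TensorProduct.comm K K' L).trans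
    ((Algebra.TensorProduct.cancelBaseChange K F F L K').symm.restrictScalars K)).injective

/-- In characteristic zero, the base change of a field extension to a field is reduced. -/
lemma isReduced_tensorProduct_of_charZero (K L K' : Type*) [Field K] [Field L] [Field K']
    [Algebra K L] [Algebra K K'] [CharZero K] : IsReduced (K' ⊗[K] L) := by
  obtain ⟨ι, v, hv⟩ := exists_isTranscendenceBasis' K L
  have := hv.isAlgebraic_field
  have := hv.1.isDomain_adjoin_tensorProduct K'
  exact isReduced_tensorProduct_of_isDomain K (IntermediateField.adjoin K (Set.range v)) L K'

end Reduced

/-! ### Bounded nil lifting implies the usual lifting. -/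

section BoundedNil

lemma Ideal.isBoundedNil_iff {A : Type*} [CommRing A] {I : Ideal A} :
    I.IsBoundedNil ↔ ∃ m : ℕ, ∀ f ∈ I, f ^ m = 0 := by
  refine exists_congr fun m ↦ ?_
  rw [Ideal.powersIdeal, Ideal.span_eq_bot]
  exact ⟨fun h f hf ↦ h _ ⟨f, hf, rfl⟩, fun h _ ⟨f, hf, hx⟩ ↦ hx ▸ h f hf⟩

variable {R : Type u} {S : Type v} [CommRing R] [CommRing S] [Algebra R S]
  {A : Type w} {C : Type*} [CommRing A] [Algebra R A] [CommRing C] [Algebra R C]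

lemma BNilFormallySmooth.exists_lift (h : BNilFormallySmooth.{u, v, w} R S) {f : A →ₐ[R] C}
    (hf : Function.Surjective f) (hker : (RingHom.ker f).IsBoundedNil) (g : S →ₐ[R] C) :
    ∃ g' : S →ₐ[R] A, f.comp g' = g := by
  let e := Ideal.quotientKerAlgEquivOfSurjective hf
  obtain ⟨g', hg'⟩ := h A (RingHom.ker f) hker (e.symm.toAlgHom.comp g)
  refine ⟨g', AlgHom.ext fun x ↦ ?_⟩
  have := congrArg e (DFunLike.congr_fun hg' x)
  simpa [e] using this

lemma BNilFormallyEtale.algHom_ext (h : BNilFormallyEtale.{u, v, w} R S) {f : A →ₐ[R] C}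
    (hker : (RingHom.ker f).IsBoundedNil) {g₁ g₂ : S →ₐ[R] A} (hg : f.comp g₁ = f.comp g₂) :
    g₁ = g₂ := by
  obtain ⟨g, -, hu⟩ := h A (RingHom.ker f) hker ((Ideal.Quotient.mkₐ R (RingHom.ker f)).comp g₁)
  rw [hu g₁ rfl, hu g₂ ?_]
  ext x
  refine Ideal.Quotient.eq.2 ?_
  rw [RingHom.mem_ker, map_sub, sub_eq_zero]
  exact (DFunLike.congr_fun hg x).symm

lemma BNilFormallyEtale.bNilFormallySmooth (h : BNilFormallyEtale.{u, v, w} R S) :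
    BNilFormallySmooth.{u, v, w} R S := fun A _ _ I hI g ↦ (h A I hI g).exists

/-- The quotient map by an ideal, with source lifted to a larger universe. -/
def Ideal.Quotient.mkULiftₐ {B : Type*} [CommRing B] [Algebra R B] (I : Ideal B) :
    ULift.{w} B →ₐ[R] B ⧸ I :=
  (Ideal.Quotient.mkₐ R I).comp ULift.algEquiv.toAlgHom

lemma Ideal.Quotient.isBoundedNil_ker_mkULiftₐ {B : Type*} [CommRing B] [Algebra R B] {I : Ideal B}
    (hI : I ^ 2 = ⊥) : (RingHom.ker (mkULiftₐ.{u, w} (R := R) I)).IsBoundedNil := by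
  refine Ideal.isBoundedNil_iff.2 ⟨2, fun x hx ↦ ULift.ext _ _ ?_⟩
  have hx' : x.down ∈ I := Ideal.Quotient.eq_zero_iff_mem.1 hx
  have := Ideal.pow_mem_pow hx' 2
  rw [hI] at this
  exact this

/-- Square-zero ideals are bounded nil with m = 2; `ULift` moves the test ring into the universe of
the hypothesis. -/
lemma BNilFormallySmooth.formallySmooth (h : BNilFormallySmooth.{u, v, max u v w} R S) :
    Algebra.FormallySmooth R S := by
  refine Algebra.FormallySmooth.iff_comp_surjective.2 fun B _ _ I hI g ↦ ?_
  obtain ⟨g', hg'⟩ := BNilFormallySmooth.exists_lift h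
    (f := Ideal.Quotient.mkULiftₐ.{u, max u v w} (R := R) I)
    (fun x ↦ by obtain ⟨b, rfl⟩ := Ideal.Quotient.mk_surjective x; exact ⟨⟨b⟩, rfl⟩)
    (Ideal.Quotient.isBoundedNil_ker_mkULiftₐ hI) g
  exact ⟨ULift.algEquiv.toAlgHom.comp g', hg'⟩

lemma BNilFormallyEtale.formallyEtale (h : BNilFormallyEtale.{u, v, max u v w} R S) :
    Algebra.FormallyEtale R S := by
  refine Algebra.FormallyEtale.iff_comp_bijective.2 fun B _ _ I hI ↦ ⟨fun g₁ g₂ hg ↦ ?_, ?_⟩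
  · have := BNilFormallyEtale.algHom_ext h
      (f := Ideal.Quotient.mkULiftₐ.{u, max u v w} (R := R) I)
      (Ideal.Quotient.isBoundedNil_ker_mkULiftₐ hI)
      (g₁ := ULift.algEquiv.symm.toAlgHom.comp g₁) (g₂ := ULift.algEquiv.symm.toAlgHom.comp g₂) hg
    exact AlgHom.ext fun x ↦ congrArg ULift.down (DFunLike.congr_fun this x)
  · exact Algebra.FormallySmooth.iff_comp_surjective.1
      h.bNilFormallySmooth.formallySmooth I hI

end BoundedNil

/-! ### Combining the two characteristics. -/

section Fields

variable {K : Type u} {L : Type v} [Field K] [Field L] [Algebra K L]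

lemma IsSeparableOverField.isGeometricallyReduced
    (h : IsSeparableOverField.{u, v, max u w} K L) : Algebra.IsGeometricallyReduced K L := by
  rw [Algebra.isGeometricallyReduced_field_iff]
  have := h (ULift.{max u w} (AlgebraicClosure K))
  exact isReduced_of_injective _
    (Algebra.TensorProduct.congr (ULift.algEquiv (R := K) (A := AlgebraicClosure K)).symm
      (AlgEquiv.refl (A₁ := L))).injective

lemma Algebra.IsGeometricallyReduced.linearIndepOn_pow [Algebra.IsGeometricallyReduced K L] (p : ℕ)
    [Fact p.Prime] [CharP K p] (s : Finset L) (hs : LinearIndepOn K _root_.id (s : Set L)) :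
    LinearIndepOn K (· ^ p) (s : Set L) :=
  linearIndepOn_pow_of_isReduced_tensorProduct (K' := AlgebraicClosure K) p
    (fun _ ↦ IsAlgClosed.exists_pow_nat_eq _ (Fact.out : p.Prime).pos) s hs

lemma Algebra.IsGeometricallyReduced.isReduced_tensorProduct [Algebra.IsGeometricallyReduced K L]
    (K' : Type*) [Field K'] [Algebra K K'] : IsReduced (K' ⊗[K] L) := by
  obtain _ | ⟨p, hp, hpK⟩ := CharP.exists' K
  · exact isReduced_tensorProduct_of_charZero K L K'
  · exact isReduced_tensorProduct_of_linearIndepOn_pow p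
      (Algebra.IsGeometricallyReduced.linearIndepOn_pow p) K'

lemma Algebra.FormallySmooth.isGeometricallyReduced [Algebra.FormallySmooth K L] :
    Algebra.IsGeometricallyReduced K L := by
  rw [Algebra.isGeometricallyReduced_field_iff]
  obtain _ | ⟨p, hp, hpK⟩ := CharP.exists' K
  · exact isReduced_tensorProduct_of_charZero K L _
  · exact isReduced_tensorProduct_of_linearIndepOn_pow p
      (Algebra.FormallySmooth.linearIndepOn_pow p) _

lemma Ideal.IsBoundedNil.exists_pow_prime_pow_eq_zero {A : Type*} [CommRing A] {I : Ideal A}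
    (hI : I.IsBoundedNil) {p : ℕ} (hp : p.Prime) : ∃ n, ∀ a ∈ I, a ^ p ^ n = 0 := by
  obtain ⟨m, hm⟩ := Ideal.isBoundedNil_iff.1 hI
  -- The exponent n = m suffices because m < p^m.
  exact ⟨m, fun a ha ↦ pow_eq_zero_of_le (Nat.lt_pow_self hp.one_lt).le (hm a ha)⟩

lemma Algebra.IsGeometricallyReduced.bNilFormallySmooth [Algebra.IsGeometricallyReduced K L] :
    BNilFormallySmooth.{u, v, w} K L := by
  intro A _ _ I hI g
  obtain _ | ⟨p, hp, hpK⟩ := CharP.exists' K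
  · have := Algebra.FormallySmooth.of_charZero K L
    obtain ⟨m, hm⟩ := Ideal.isBoundedNil_iff.1 hI
    exact Algebra.FormallySmooth.exists_lift I (Ideal.isNilpotent_of_forall_pow_eq_zero K hm) g
  · obtain ⟨n, hn⟩ := hI.exists_pow_prime_pow_eq_zero hp.out
    exact exists_lift_of_ker_pow_prime_pow_eq_zero p
      (Algebra.IsGeometricallyReduced.linearIndepOn_pow p) n (Ideal.Quotient.mkₐ_surjective K I)
      (fun a ha ↦ hn a (Ideal.Quotient.eq_zero_iff_mem.1 ha)) g

lemma Algebra.FormallyUnramified.algHom_ext_of_isBoundedNil [Algebra.FormallyUnramified K L]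
    {A : Type*} [CommRing A] [Algebra K A] {I : Ideal A} (hI : I.IsBoundedNil)
    {f₁ f₂ : L →ₐ[K] A}
    (h : (Ideal.Quotient.mkₐ K I).comp f₁ = (Ideal.Quotient.mkₐ K I).comp f₂) : f₁ = f₂ := by
  obtain _ | ⟨p, hp, hpK⟩ := CharP.exists' K
  · obtain ⟨m, hm⟩ := Ideal.isBoundedNil_iff.1 hI
    exact Algebra.FormallyUnramified.lift_unique I
      (Ideal.isNilpotent_of_forall_pow_eq_zero K hm) f₁ f₂ h
  · obtain ⟨n, hn⟩ := hI.exists_pow_prime_pow_eq_zero hp.out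
    exact Algebra.FormallyUnramified.algHom_ext_of_ker_pow_prime_pow_eq_zero p n
      (fun a ha ↦ hn a (Ideal.Quotient.eq_zero_iff_mem.1 ha)) h

lemma Algebra.FormallyEtale.bNilFormallyEtale [Algebra.FormallyEtale K L] :
    BNilFormallyEtale.{u, v, w} K L := by
  intro A _ _ I hI g
  have := Algebra.FormallySmooth.isGeometricallyReduced (K := K) (L := L)
  obtain ⟨f, hf⟩ := Algebra.IsGeometricallyReduced.bNilFormallySmooth A I hI g
  exact ⟨f, hf, fun f' hf' ↦
    Algebra.FormallyUnramified.algHom_ext_of_isBoundedNil hI (hf'.trans hf.symm)⟩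

end Fields

theorem mainTheorem11 (K : Type u) (L : Type v) [Field K] [Field L] [Algebra K L] :
    (Algebra.FormallyEtale K L ↔ BNilFormallyEtale.{u, v, max u v w} K L) ∧
    List.TFAE [
      BNilFormallySmooth.{u, v, max u v w} K L,
      Algebra.FormallySmooth K L,
      Algebra.IsGeometricallyReduced K L,
      IsSeparableOverField.{u, v, max u v w} K L] := by
  refine ⟨⟨fun _ ↦ Algebra.FormallyEtale.bNilFormallyEtale,
    fun h ↦ BNilFormallyEtale.formallyEtale.{u, v, w} h⟩, ?_⟩
  tfae_have 1 → 2 := fun h ↦ BNilFormallySmooth.formallySmooth.{u, v, w} h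
  tfae_have 2 → 3 := fun _ ↦ Algebra.FormallySmooth.isGeometricallyReduced
  tfae_have 3 → 1 := fun _ ↦ Algebra.IsGeometricallyReduced.bNilFormallySmooth
  tfae_have 3 → 4 := fun _ K' _ _ ↦ Algebra.IsGeometricallyReduced.isReduced_tensorProduct K'
  tfae_have 4 → 3 := fun h ↦ IsSeparableOverField.isGeometricallyReduced.{u, v, max v w} h
  tfae_finish
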